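/- Let $d\ge 1$, let $q_1,\dots,q_d$ be positive integers, $Q=q_1q_2\cdots q_d$, $\Gamma=q_1\mathbb{Z}\oplus\cdots\oplus q_d\mathbb{Z}$, and let $V:\mathbb{Z}^d\to\mathbb{R}$ be $\Gamma$-periodic, i.e. $V(n+\gamma)=V(n)$ for all $n\in\mathbb{Z}^d$, $\gamma\in\Gamma$. Let $\Delta$ be the discrete Laplacian, $(\Delta u)(n)=\sum_{\|n'-n\|_1=1}u(n')$ for $u:\mathbb{Z}^d\to\mathbb{C}$. For $k\in\mathbb{R}^d$ let $D_V(k)$ be the operator $\Delta+V$ acting on the functions $u:\mathbb{Z}^d\to\mathbb{C}$ with the Floquet--Bloch boundary condition $$u(n+q_j\mathbf{e}_j)=e^{2\pi i k_j}u(n),\qquad j=1,\dots,d,\ n\in\mathbb{Z}^d,$$ where $\mathbf{e}_1,\dots,\mathbf{e}_d$ is the standard basis; in terms of the values of $u$ on $\{n: 0\le n_j\le q_j-1\}$ it is a Hermitian $Q\times Q$ matrix. Let $\lambda_V^1(k)\le\lambda_V^2(k)\le\cdots\le\lambda_V^Q(k)$ be its eigenvalues, counted with multiplicity, and let $L_N^d=\{0,1,\dots,N-1\}^d$.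 Then for all $s,w\in\{1,\dots,Q\}$, $$\lim_{N\to\infty}\ \sup_{\substack{m\in L_N^d\\ m\ne 0}}\ \frac{\#\{r\in L_N^d:\ \lambda_V^s(\frac{r+m}{N})-\lambda_V^w(\frac{r}{N})=0\}}{N^d}=0 .$$ -/

import Mathlib

open Filter Topology

noncomputable section

namespace PeriodicSchrodinger

/-- The nearest neighbours of `n` in `ℤ^d`: all `n'` with `‖n - n'‖₁ = 1`
(see `mem_neighbors`; the box only makes the finiteness visible). -/
def neighbors {d : ℕ} (n : Fin d → ℤ) : Finset (Fin d → ℤ) :=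
  {n' ∈ Finset.Icc (n - 1) (n + 1) | ∑ i, |n i - n' i| = 1}

theorem mem_neighbors {d : ℕ} (n n' : Fin d → ℤ) :
    n' ∈ neighbors n ↔ ∑ i, |n i - n' i| = 1 := by
  unfold neighbors
  rw [Finset.mem_filter, and_iff_right_iff_imp]
  intro h
  have key : ∀ i, |n i - n' i| ≤ 1 := fun i => by
    rw [← h]
    exact Finset.single_le_sum (f := fun i => |n i - n' i|) (fun i _ => abs_nonneg _)
      (Finset.mem_univ i)
  rw [Finset.mem_Icc]
  constructor <;> intro i <;> have := abs_le.mp (key i) <;>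
    simp only [Pi.sub_apply, Pi.add_apply, Pi.one_apply] <;> omega

/-- The discrete Laplacian `(Δu)(n) = ∑_{‖n' - n‖₁ = 1} u(n')` on functions `ℤ^d → ℂ`. -/
def laplacian (d : ℕ) : ((Fin d → ℤ) → ℂ) →ₗ[ℂ] ((Fin d → ℤ) → ℂ) where
  toFun u := fun n => ∑ n' ∈ neighbors n, u n'
  map_add' u v := by
    funext n
    simp [Finset.sum_add_distrib]
  map_smul' c u := by
    funext n
    simp [Finset.mul_sum]

/-- Multiplication by the real potential `V`. -/
def potential {d : ℕ} (V : (Fin d → ℤ) → ℝ) :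
    ((Fin d → ℤ) → ℂ) →ₗ[ℂ] ((Fin d → ℤ) → ℂ) where
  toFun u := fun n => (V n : ℂ) * u n
  map_add' u v := by
    funext n
    simp [mul_add]
  map_smul' c u := by
    funext n
    simp [mul_left_comm]

/-- The discrete Schrödinger operator `Δ + V`. -/
def schrodinger {d : ℕ} (V : (Fin d → ℤ) → ℝ) :
    ((Fin d → ℤ) → ℂ) →ₗ[ℂ] ((Fin d → ℤ) → ℂ) :=
  laplacian d + potential V

/-- `V` is `Γ`-periodic for `Γ = q₁ℤ ⊕ ⋯ ⊕ q_dℤ`. -/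
def IsPeriodic {d : ℕ} (q : Fin d → ℕ) (V : (Fin d → ℤ) → ℝ) : Prop :=
  ∀ γ : Fin d → ℤ, (∀ j, (q j : ℤ) ∣ γ j) → ∀ n, V (n + γ) = V n

/-- The Floquet-Bloch boundary condition `u(n + q_j e_j) = e^{2πi k_j} u(n)`. -/
def IsFloquet {d : ℕ} (q : Fin d → ℕ) (k : Fin d → ℝ) (u : (Fin d → ℤ) → ℂ) : Prop :=
  ∀ (j : Fin d) (n : Fin d → ℤ),
    u (n + Pi.single j (q j : ℤ)) = Complex.exp (2 * Real.pi * Complex.I * k j) * u n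

/-- The fundamental cell `{n : 0 ≤ n_j ≤ q_j - 1}`, of cardinality `Q = q₁ ⋯ q_d`. -/
abbrev Cell {d : ℕ} (q : Fin d → ℕ) : Type := (j : Fin d) → Fin (q j)

/-- A point of the fundamental cell, seen in `ℤ^d`. -/
def Cell.toLattice {d : ℕ} {q : Fin d → ℕ} (a : Cell q) : Fin d → ℤ := fun j => ((a j : ℕ) : ℤ)

/-- The function on `ℤ^d` that satisfies the Floquet-Bloch boundary condition and that is `1` at
the point `a` of the fundamental cell and `0` at the other points of the cell
(see `isFloquet_floquetBasis` and `floquetBasis_toLattice`). -/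
def floquetBasis {d : ℕ} (q : Fin d → ℕ) (k : Fin d → ℝ) (a : Cell q) : (Fin d → ℤ) → ℂ :=
  fun n =>
    if ∀ j, (q j : ℤ) ∣ n j - a.toLattice j then
      Complex.exp (2 * Real.pi * Complex.I *
        ∑ j, (k j : ℂ) * (((n j - a.toLattice j) / (q j : ℤ) : ℤ) : ℂ))
    else 0

/-- The `Q × Q` matrix `D_V(k)` of `Δ + V` with the Floquet-Bloch boundary condition
(see `floquetMatrix_mulVec`). -/
def floquetMatrix {d : ℕ} (q : Fin d → ℕ) (V : (Fin d → ℤ) → ℝ) (k : Fin d → ℝ) :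
    Matrix (Cell q) (Cell q) ℂ :=
  Matrix.of fun a b => schrodinger V (floquetBasis q k b) a.toLattice

theorem isFloquet_floquetBasis {d : ℕ} (q : Fin d → ℕ) (hq : ∀ j, 0 < q j) (k : Fin d → ℝ)
    (a : Cell q) : IsFloquet q k (floquetBasis q k a) := by
  intro j n
  have hiff : (∀ i, (q i : ℤ) ∣ (n + Pi.single j (q j : ℤ) : Fin d → ℤ) i - a.toLattice i) ↔
      ∀ i, (q i : ℤ) ∣ n i - a.toLattice i := by
    refine forall_congr' fun i => ?_
    by_cases hij : i = j
    · subst hij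
      have : (n + Pi.single i (q i : ℤ) : Fin d → ℤ) i - a.toLattice i = (n i - a.toLattice i) + q i := by
        simp; ring
      rw [this, dvd_add_self_right]
    · simp [hij]
  unfold floquetBasis
  by_cases h : ∀ i, (q i : ℤ) ∣ n i - a.toLattice i
  · rw [if_pos (hiff.mpr h), if_pos h, ← Complex.exp_add, ← mul_add]
    congr 2
    have : ∀ i, (k i : ℂ) *
        ((((n + Pi.single j (q j : ℤ) : Fin d → ℤ) i - a.toLattice i) / (q i : ℤ) : ℤ) : ℂ) =
        (if i = j then (k j : ℂ) else 0) +
          (k i : ℂ) * (((n i - a.toLattice i) / (q i : ℤ) : ℤ) : ℂ) := by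
      intro i
      by_cases hij : i = j
      · subst hij
        have h1 : (n + Pi.single i (q i : ℤ) : Fin d → ℤ) i - a.toLattice i =
            (n i - a.toLattice i) + q i := by
          simp; ring
        have h2 : (q i : ℤ) ≠ 0 := by exact_mod_cast (hq i).ne'
        rw [h1, Int.add_ediv_of_dvd_right (dvd_refl _), Int.ediv_self h2]
        push_cast
        simp; ring
      · simp [hij]
    rw [Finset.sum_congr rfl fun i _ => this i, Finset.sum_add_distrib]
    simp
  · rw [if_neg (fun h' => h (hiff.mp h')), if_neg h, mul_zero]

theorem Cell.eq_of_dvd {d : ℕ} {q : Fin d → ℕ} (a b : Cell q)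
    (h : ∀ j, (q j : ℤ) ∣ b.toLattice j - a.toLattice j) : b = a := by
  funext j
  have h1 := Int.eq_zero_of_abs_lt_dvd (h j) (by
    have := (a j).isLt
    have := (b j).isLt
    unfold Cell.toLattice
    rw [abs_lt]
    omega)
  unfold Cell.toLattice at h1
  ext
  omega

theorem floquetBasis_toLattice {d : ℕ} (q : Fin d → ℕ) (k : Fin d → ℝ) (a b : Cell q) :
    floquetBasis q k a b.toLattice = if b = a then 1 else 0 := by
  unfold floquetBasis
  by_cases h : b = a
  · subst h
    simp
  · rw [if_neg h, if_neg (fun h' => h (Cell.eq_of_dvd a b h'))]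

/-- The representative in the fundamental cell of a lattice point. -/
def residue {d : ℕ} (q : Fin d → ℕ) (hq : ∀ j, 0 < q j) (n : Fin d → ℤ) : Cell q :=
  fun j => ⟨(n j % (q j : ℤ)).toNat, by
    have h := hq j
    have h1 := Int.emod_nonneg (n j) (b := (q j : ℤ)) (by omega)
    have h2 := Int.emod_lt_of_pos (n j) (b := (q j : ℤ)) (by omega)
    omega⟩

theorem residue_toLattice {d : ℕ} (q : Fin d → ℕ) (hq : ∀ j, 0 < q j) (n : Fin d → ℤ)
    (j : Fin d) : (residue q hq n).toLattice j = n j % (q j : ℤ) := by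
  have h := hq j
  have h1 := Int.emod_nonneg (n j) (b := (q j : ℤ)) (by omega)
  simp only [residue, Cell.toLattice]
  omega

/-- A function with the Floquet-Bloch boundary condition is determined by its values on the cell. -/
theorem IsFloquet.eq_zero {d : ℕ} {q : Fin d → ℕ} (hq : ∀ j, 0 < q j) {k : Fin d → ℝ}
    {u : (Fin d → ℤ) → ℂ} (hu : IsFloquet q k u) (h0 : ∀ a : Cell q, u a.toLattice = 0) :
    u = 0 := by
  have step : ∀ (j : Fin d) (c : ℤ) (n : Fin d → ℤ),
      u (n + Pi.single j (c * (q j : ℤ))) = 0 ↔ u n = 0 := by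
    intro j c
    induction c using Int.induction_on with
    | zero => intro n; simp
    | succ c ih =>
      intro n
      rw [← ih n, add_mul, one_mul, Pi.single_add, ← add_assoc, hu j]
      simp
    | pred c ih =>
      intro n
      rw [← ih n]
      have : n + Pi.single j (-(c : ℤ) * (q j : ℤ)) =
          (n + Pi.single j ((-(c : ℤ) - 1) * (q j : ℤ))) + Pi.single j (q j : ℤ) := by
        rw [add_assoc, ← Pi.single_add]
        congr 2
        ring
      rw [this, hu j]
      simp
  have many : ∀ (t : Finset (Fin d)) (c : Fin d → ℤ) (n : Fin d → ℤ),
      u (n + ∑ j ∈ t, Pi.single j (c j * (q j : ℤ))) = 0 ↔ u n = 0 := by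
    intro t c
    induction t using Finset.induction_on with
    | empty => intro n; simp
    | insert j t hj ih =>
      intro n
      rw [Finset.sum_insert hj, ← add_assoc, ih, step]
  funext n
  have h1 : (residue q hq n).toLattice +
      ∑ j, Pi.single j ((n j / (q j : ℤ)) * (q j : ℤ)) = n := by
    funext i
    rw [Pi.add_apply, Finset.univ_sum_single (fun j => (n j / (q j : ℤ)) * (q j : ℤ)),
      residue_toLattice]
    exact Int.emod_add_ediv_mul (n i) (q i : ℤ)
  rw [← h1]
  exact (many _ _ _).mpr (h0 _)

theorem IsFloquet.eq_sum {d : ℕ} {q : Fin d → ℕ} (hq : ∀ j, 0 < q j) {k : Fin d → ℝ}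
    {u : (Fin d → ℤ) → ℂ} (hu : IsFloquet q k u) :
    u = ∑ a : Cell q, u a.toLattice • floquetBasis q k a := by
  refine sub_eq_zero.mp (IsFloquet.eq_zero hq (k := k) ?_ ?_)
  · intro j n
    have hb : ∀ a : Cell q, floquetBasis q k a (n + Pi.single j (q j : ℤ)) = _ :=
      fun a => isFloquet_floquetBasis q hq k a j n
    simp only [Pi.sub_apply, Finset.sum_apply, Pi.smul_apply, smul_eq_mul, hu j n, hb, mul_sub,
      Finset.mul_sum]
    congr 1
    exact Finset.sum_congr rfl fun a _ => by ring
  · intro b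
    simp [floquetBasis_toLattice]

/-- For `u` with the Floquet-Bloch boundary condition, `D_V(k)` maps the values of `u` on the
fundamental cell to the values of `(Δ + V)u` there. -/
theorem floquetMatrix_mulVec {d : ℕ} (q : Fin d → ℕ) (hq : ∀ j, 0 < q j)
    (V : (Fin d → ℤ) → ℝ) (k : Fin d → ℝ) (u : (Fin d → ℤ) → ℂ) (hu : IsFloquet q k u)
    (a : Cell q) :
    (floquetMatrix q V k).mulVec (fun b => u b.toLattice) a = schrodinger V u a.toLattice := by
  conv_rhs => rw [hu.eq_sum hq]
  simp only [map_sum, map_smul, Finset.sum_apply, Pi.smul_apply, smul_eq_mul, Matrix.mulVec,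
    dotProduct, floquetMatrix, Matrix.of_apply]
  exact Finset.sum_congr rfl fun b _ => mul_comm _ _

theorem floquetMatrix_isHermitian {d : ℕ} (q : Fin d → ℕ) (V : (Fin d → ℤ) → ℝ)
    (k : Fin d → ℝ) : (floquetMatrix q V k).IsHermitian := by
  ext a b
  rw [Matrix.conjTranspose_apply]
  simp only [floquetMatrix, Matrix.of_apply, schrodinger, LinearMap.add_apply, Pi.add_apply,
    laplacian, potential, LinearMap.coe_mk, AddHom.coe_mk, floquetBasis_toLattice, star_add,
    star_sum]
  congr 1
  · refine Finset.sum_nbij' (fun l => a.toLattice + b.toLattice - l)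
      (fun l => a.toLattice + b.toLattice - l) ?_ ?_ ?_ ?_ ?_
    · intro l hl
      rw [mem_neighbors] at hl ⊢
      rw [← hl]
      refine Finset.sum_congr rfl fun i _ => ?_
      rw [← abs_neg]
      simp only [Pi.add_apply, Pi.sub_apply]
      congr 1
      ring
    · intro l hl
      rw [mem_neighbors] at hl ⊢
      rw [← hl]
      refine Finset.sum_congr rfl fun i _ => ?_
      rw [← abs_neg]
      simp only [Pi.add_apply, Pi.sub_apply]
      congr 1
      ring
    · intro l _
      simp
    · intro l _
      simp
    · intro l _
      have e : ∀ j, (a.toLattice + b.toLattice - l) j - b.toLattice j =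
          -(l j - a.toLattice j) := by
        intro j
        simp only [Pi.add_apply, Pi.sub_apply]
        ring
      unfold floquetBasis
      simp only [e, dvd_neg]
      by_cases h : ∀ j, (q j : ℤ) ∣ l j - a.toLattice j
      · rw [if_pos h, if_pos h, Complex.star_def, ← Complex.exp_conj]
        congr 1
        simp only [map_mul, map_sum, Complex.conj_ofReal, Complex.conj_I, Complex.conj_ofNat,
          map_intCast, Int.neg_ediv_of_dvd (h _)]
        push_cast
        simp
      · rw [if_neg h, if_neg h, star_zero]
  · by_cases h : a = b
    · subst h
      simp
    · simp [h, Ne.symm h]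

theorem card_cell {d : ℕ} (q : Fin d → ℕ) : ∏ j, q j = Fintype.card (Cell q) := by
  simp [Cell]

/-- The spectral band functions: `band q V j k` is the `j`-th eigenvalue of `D_V(k)` in
non-decreasing order, counted with multiplicity (Mathlib's `eigenvalues₀` lists the eigenvalues of
a Hermitian matrix in non-increasing order). The index `j` runs over `Fin Q`, `Q = q₁ ⋯ q_d`. -/
def band {d : ℕ} (q : Fin d → ℕ) (V : (Fin d → ℤ) → ℝ) (j : Fin (∏ i, q i)) (k : Fin d → ℝ) : ℝ :=
  (floquetMatrix_isHermitian q V k).eigenvalues₀ (Fin.rev (Fin.cast (card_cell q) j))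

theorem band_monotone {d : ℕ} (q : Fin d → ℕ) (V : (Fin d → ℤ) → ℝ) (k : Fin d → ℝ) :
    Monotone fun j => band q V j k := by
  intro i j hij
  refine (floquetMatrix_isHermitian q V k).eigenvalues₀_antitone ?_
  rw [Fin.rev_le_rev]
  exact hij

/-- `L_N^d = {0, 1, …, N - 1}^d`. -/
def box (d N : ℕ) : Finset (Fin d → ℕ) := Fintype.piFinset fun _ => Finset.range N

end PeriodicSchrodinger

end

/-! Put `ζ = exp (2πi/N)`, `y = ζ^m` and `z = ζ^r`. If the two band values coincide, the Floquet
matrices with multipliers `y z` and `z` share an eigenvalue, so the Sylvester determinant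
`bandResultant q V y z = det (A ⊗ 1 - 1 ⊗ B)` vanishes (`bandResultant_eq_zero`). It is one fixed
Laurent polynomial in `(y, z)`, independent of `N`, `m`, `r`. Whenever `z ↦ bandResultant q V y z`
is not identically zero, Schwartz–Zippel on the grid of `N`-th roots of unity leaves at most `C
N^(d-1)` zeros, with `C` a total degree that does not depend on `y` (`IsLaurent.exists_card_le`).
This bounds the supremum by `C / N`.

What remains is nonvanishing for `y ≠ 1` (`exists_bandResultant_ne_zero`). If `y j ≠ 1`, let `z j →
∞`. After a diagonal gauge and rescaling, hopping in direction `+e_j` dominates: the two matrices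
tend to `c j • S` and `S`, where `S` is a cyclic shift with `S ^ q j = 1` and `c j ^ q j = y j`.
Their `q j`-th powers are the distinct scalars `y j` and `1`, so the limits have no common
eigenvalue; by continuity the determinant is nonzero for large finite `z j`. -/

noncomputable section

namespace PeriodicSchrodinger

open scoped Kronecker Matrix

/-! ### Sylvester determinants as a test for common eigenvalues -/

section Sylvester

variable {m n : Type*} [Fintype m] [Fintype n] [DecidableEq m] [DecidableEq n]

/-- The matrix of the Sylvester operator, `A ⊗ 1 - 1 ⊗ B`. -/
def sylvester (A : Matrix m m ℂ) (B : Matrix n n ℂ) : Matrix (m × n) (m × n) ℂ :=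
  A ⊗ₖ (1 : Matrix n n ℂ) - (1 : Matrix m m ℂ) ⊗ₖ B

/-- Both `A ⊗ 1` and `1 ⊗ B` multiply `u ⊗ v` by `c`, so `u ⊗ v` is a nonzero kernel vector. -/
theorem det_sylvester_eq_zero {A : Matrix m m ℂ} {B : Matrix n n ℂ} {c : ℂ} {u : m → ℂ}
    {v : n → ℂ} (hu : u ≠ 0) (hv : v ≠ 0) (hA : A *ᵥ u = c • u) (hB : B *ᵥ v = c • v) :
    (sylvester A B).det = 0 := by
  rw [← Matrix.exists_mulVec_eq_zero_iff]
  refine ⟨fun p => u p.1 * v p.2, ?_, ?_⟩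
  · obtain ⟨a, ha⟩ := Function.ne_iff.mp hu
    obtain ⟨b, hb⟩ := Function.ne_iff.mp hv
    exact Function.ne_iff.mpr ⟨(a, b), mul_ne_zero ha hb⟩
  · ext ⟨a, b⟩
    have h1 : ∑ i, A a i * u i = c * u a := congrFun hA a
    have h2 : ∑ j, B b j * v j = c * v b := congrFun hB b
    have e1 : ((A ⊗ₖ (1 : Matrix n n ℂ)) *ᵥ fun p => u p.1 * v p.2) (a, b) = c * u a * v b := by
      rw [← h1, Finset.sum_mul]
      simp [Matrix.mulVec, dotProduct, Fintype.sum_prod_type, Matrix.kroneckerMap_apply,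
        Matrix.one_apply, mul_assoc]
    have e2 : (((1 : Matrix m m ℂ) ⊗ₖ B) *ᵥ fun p => u p.1 * v p.2) (a, b) = u a * (c * v b) := by
      rw [← h2, Finset.mul_sum]
      simp [Matrix.mulVec, dotProduct, Fintype.sum_prod_type, Matrix.kroneckerMap_apply,
        Matrix.one_apply, mul_left_comm]
    rw [sylvester, Matrix.sub_mulVec, Pi.sub_apply, e1, e2, Pi.zero_apply]
    ring

/-- `X = A ⊗ 1` and `Y = 1 ⊗ B` commute, so `X - Y` divides `X ^ k - Y ^ k`, which is the invertible
scalar `c - c'`. -/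
theorem det_sylvester_ne_zero_of_pow {A : Matrix m m ℂ} {B : Matrix n n ℂ} {k : ℕ} {c c' : ℂ}
    (hA : A ^ k = c • 1) (hB : B ^ k = c' • 1) (hc : c ≠ c') : (sylvester A B).det ≠ 0 := by
  have hcomm : Commute (A ⊗ₖ (1 : Matrix n n ℂ)) ((1 : Matrix m m ℂ) ⊗ₖ B) := by
    simp [Commute, SemiconjBy, ← Matrix.mul_kronecker_mul]
  have h1 : ∀ l : ℕ, (A ⊗ₖ (1 : Matrix n n ℂ)) ^ l = (A ^ l) ⊗ₖ (1 : Matrix n n ℂ) := by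
    intro l
    induction l with
    | zero => simp
    | succ l ih => rw [pow_succ, ih, ← Matrix.mul_kronecker_mul, pow_succ, one_mul]
  have h2 : ∀ l : ℕ, ((1 : Matrix m m ℂ) ⊗ₖ B) ^ l = (1 : Matrix m m ℂ) ⊗ₖ (B ^ l) := by
    intro l
    induction l with
    | zero => simp
    | succ l ih => rw [pow_succ, ih, ← Matrix.mul_kronecker_mul, pow_succ, one_mul]
  have h := hcomm.geom_sum₂_mul k
  rw [h1 k, h2 k, hA, hB, Matrix.smul_kronecker, Matrix.kronecker_smul, Matrix.one_kronecker_one,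
    ← sub_smul] at h
  intro h0
  have := congrArg Matrix.det h
  rw [← sylvester, Matrix.det_mul, h0, mul_zero, Matrix.det_smul, Matrix.det_one,
    mul_one] at this
  exact pow_ne_zero _ (sub_ne_zero.mpr hc) this.symm

/-- Simultaneous rescaling and conjugation preserve nonsingularity of the Sylvester operator. -/
theorem det_sylvester_ne_zero_of_conj {A A' D : Matrix m m ℂ} {B B' E : Matrix n n ℂ} {c : ℂ}
    (hD : D.det ≠ 0) (hE : E.det ≠ 0) (hA : (c • A) * D = D * A') (hB : (c • B) * E = E * B')
    (h : (sylvester A' B').det ≠ 0) : (sylvester A B).det ≠ 0 := by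
  have key : (c • sylvester A B) * (D ⊗ₖ E) = (D ⊗ₖ E) * sylvester A' B' := by
    rw [sylvester, sylvester, smul_sub, ← Matrix.smul_kronecker, ← Matrix.kronecker_smul, mul_sub,
      sub_mul]
    simp only [← Matrix.mul_kronecker_mul, hA, hB, one_mul, mul_one]
  intro h0
  have := congrArg Matrix.det key
  rw [Matrix.det_mul, Matrix.det_mul, Matrix.det_smul, h0, mul_zero, zero_mul,
    Matrix.det_kronecker] at this
  exact mul_ne_zero (mul_ne_zero (pow_ne_zero _ hD) (pow_ne_zero _ hE)) h this.symm

end Sylvester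

/-! ### Laurent polynomial functions and their zeros on grids -/

section Laurent

variable {d : ℕ}

/-- `f(y, z)` is a Laurent polynomial function of `y, z ∈ (ℂ \ {0})^d`. -/
def IsLaurent (f : (Fin d → ℂ) → (Fin d → ℂ) → ℂ) : Prop :=
  ∃ (M : ℕ) (p : MvPolynomial (Fin d) (MvPolynomial (Fin d) ℂ)), ∀ y z : Fin d → ℂ,
    (∀ i, y i ≠ 0) → (∀ i, z i ≠ 0) →
      ((∏ i, y i) * ∏ i, z i) ^ M * f y z = (p.map (MvPolynomial.eval y)).eval z

namespace IsLaurent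

variable {f g : (Fin d → ℂ) → (Fin d → ℂ) → ℂ}

theorem const (c : ℂ) : IsLaurent (d := d) fun _ _ => c :=
  ⟨0, MvPolynomial.C (MvPolynomial.C c), by simp⟩

theorem left (i : Fin d) : IsLaurent fun y _ => y i :=
  ⟨0, MvPolynomial.C (MvPolynomial.X i), by simp⟩

theorem right (i : Fin d) : IsLaurent fun _ z => z i :=
  ⟨0, MvPolynomial.X i, by simp⟩

theorem left_inv (i : Fin d) : IsLaurent fun y _ => (y i)⁻¹ := by
  refine ⟨1, MvPolynomial.C (∏ k ∈ Finset.univ.erase i, MvPolynomial.X k) *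
    ∏ k, MvPolynomial.X k, fun y z hy _ => ?_⟩
  rw [← Finset.mul_prod_erase _ _ (Finset.mem_univ i)]
  simp only [map_mul, map_prod, MvPolynomial.map_C, MvPolynomial.map_X, MvPolynomial.eval_C,
    MvPolynomial.eval_X]
  field_simp [hy i]

theorem right_inv (i : Fin d) : IsLaurent fun _ z => (z i)⁻¹ := by
  refine ⟨1, MvPolynomial.C (∏ k, MvPolynomial.X k) *
    ∏ k ∈ Finset.univ.erase i, MvPolynomial.X k, fun y z _ hz => ?_⟩
  rw [← Finset.mul_prod_erase _ (fun i => z i) (Finset.mem_univ i)]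
  simp only [map_mul, map_prod, MvPolynomial.map_C, MvPolynomial.map_X, MvPolynomial.eval_C,
    MvPolynomial.eval_X]
  field_simp [hz i]

theorem mul (hf : IsLaurent f) (hg : IsLaurent g) : IsLaurent fun y z => f y z * g y z := by
  obtain ⟨M, p, hp⟩ := hf
  obtain ⟨M', p', hp'⟩ := hg
  refine ⟨M + M', p * p', fun y z hy hz => ?_⟩
  rw [map_mul, map_mul, ← hp y z hy hz, ← hp' y z hy hz]
  ring

theorem add (hf : IsLaurent f) (hg : IsLaurent g) : IsLaurent fun y z => f y z + g y z := by
  obtain ⟨M, p, hp⟩ := hf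
  obtain ⟨M', p', hp'⟩ := hg
  let e : MvPolynomial (Fin d) (MvPolynomial (Fin d) ℂ) :=
    MvPolynomial.C (∏ k, MvPolynomial.X k) * ∏ k, MvPolynomial.X k
  -- `e` represents the product of all variables; its powers bring both summands to a common
  -- denominator.
  refine ⟨M + M', e ^ M' * p + e ^ M * p', fun y z hy hz => ?_⟩
  have he : (e.map (MvPolynomial.eval y)).eval z = (∏ i, y i) * ∏ i, z i := by
    simp [e]
  rw [map_add, map_add, map_mul, map_mul, map_mul, map_mul, map_pow, map_pow, map_pow, map_pow,
    ← hp y z hy hz, ← hp' y z hy hz, he]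
  ring

theorem sum {ι : Type*} (s : Finset ι) {f : ι → (Fin d → ℂ) → (Fin d → ℂ) → ℂ}
    (hf : ∀ i ∈ s, IsLaurent (f i)) : IsLaurent fun y z => ∑ i ∈ s, f i y z := by
  classical
  induction s using Finset.induction_on with
  | empty => simpa using const 0
  | insert a s ha ih =>
    simp only [Finset.sum_insert ha]
    exact (hf a (by simp)).add (ih fun i hi => hf i (by simp [hi]))

theorem prod {ι : Type*} (s : Finset ι) {f : ι → (Fin d → ℂ) → (Fin d → ℂ) → ℂ}
    (hf : ∀ i ∈ s, IsLaurent (f i)) : IsLaurent fun y z => ∏ i ∈ s, f i y z := by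
  classical
  induction s using Finset.induction_on with
  | empty => simpa using const 1
  | insert a s ha ih =>
    simp only [Finset.prod_insert ha]
    exact (hf a (by simp)).mul (ih fun i hi => hf i (by simp [hi]))

theorem pow (hf : IsLaurent f) (n : ℕ) : IsLaurent fun y z => f y z ^ n := by
  simpa using prod (Finset.range n) fun _ _ => hf

theorem zpow (hf : IsLaurent f) (hf' : IsLaurent fun y z => (f y z)⁻¹) (n : ℤ) :
    IsLaurent fun y z => f y z ^ n := by
  cases n with
  | ofNat n => simpa using hf.pow n
  | negSucc n => simpa [zpow_negSucc] using hf'.pow (n + 1)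

theorem det {m : Type*} [Fintype m] [DecidableEq m]
    {A : (Fin d → ℂ) → (Fin d → ℂ) → Matrix m m ℂ}
    (hA : ∀ a b, IsLaurent fun y z => A y z a b) : IsLaurent fun y z => (A y z).det := by
  simp only [Matrix.det_apply']
  exact sum _ fun σ _ => (const _).mul (prod _ fun i _ => hA _ _)

theorem sylvester {m n : Type*} [Fintype m] [Fintype n] [DecidableEq m] [DecidableEq n]
    {A : (Fin d → ℂ) → (Fin d → ℂ) → Matrix m m ℂ} {B : (Fin d → ℂ) → (Fin d → ℂ) → Matrix n n ℂ}
    (hA : ∀ a b, IsLaurent fun y z => A y z a b) (hB : ∀ a b, IsLaurent fun y z => B y z a b) :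
    IsLaurent fun y z => (PeriodicSchrodinger.sylvester (A y z) (B y z)).det := by
  refine det fun a b => ?_
  simp only [PeriodicSchrodinger.sylvester, Matrix.sub_apply, Matrix.kroneckerMap_apply,
    sub_eq_add_neg, ← neg_one_mul (_ * _)]
  exact ((hA _ _).mul (const _)).add ((const _).mul ((const _).mul (hB _ _)))

end IsLaurent

/-- A Laurent polynomial function has few zeros `z` on a finite grid `S ^ d` with `0 ∉ S`, uniformly
in the first variable `y`. -/
theorem IsLaurent.exists_card_le {f : (Fin d → ℂ) → (Fin d → ℂ) → ℂ} (hf : IsLaurent f) :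
    ∃ C : ℕ, ∀ y : Fin d → ℂ, (∀ i, y i ≠ 0) → (∃ z : Fin d → ℂ, (∀ i, z i ≠ 0) ∧ f y z ≠ 0) →
      ∀ S : Finset ℂ, 0 ∉ S → ∀ T : Finset (Fin d → ℂ), (∀ z ∈ T, (∀ i, z i ∈ S) ∧ f y z = 0) →
        (T.card : ℝ) / (S.card : ℝ) ^ d ≤ C / S.card := by
  obtain ⟨M, p, hp⟩ := hf
  refine ⟨p.totalDegree, fun y hy ⟨z₀, hz₀, hfz₀⟩ S hS T hT => ?_⟩
  have hne : p.map (MvPolynomial.eval y) ≠ 0 := by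
    intro h
    have := hp y z₀ hy hz₀
    rw [h, map_zero] at this
    refine mul_ne_zero (pow_ne_zero _ (mul_ne_zero ?_ ?_)) hfz₀ this
    · exact Finset.prod_ne_zero_iff.mpr fun i _ => hy i
    · exact Finset.prod_ne_zero_iff.mpr fun i _ => hz₀ i
  have hsz := MvPolynomial.schwartz_zippel_totalDegree hne S
  -- Specialising `y` in the coefficients can only shrink the support in `z`; this makes the
  -- constant uniform in `y`.
  have hdeg : (p.map (MvPolynomial.eval y)).totalDegree ≤ p.totalDegree :=
    Finset.sup_mono (MvPolynomial.support_map_subset _ _)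
  have hcard : T.card ≤ ({z ∈ Fintype.piFinset fun _ => S |
      MvPolynomial.eval z (p.map (MvPolynomial.eval y)) = 0} : Finset (Fin d → ℂ)).card := by
    refine Finset.card_le_card fun z hz => ?_
    obtain ⟨h1, h2⟩ := hT z hz
    rw [Finset.mem_filter, Fintype.mem_piFinset]
    refine ⟨h1, ?_⟩
    rw [← hp y z hy fun i h => hS (h ▸ h1 i), h2, mul_zero]
  have h3 : (T.card : ℚ≥0) / (S.card : ℚ≥0) ^ d ≤ p.totalDegree / S.card := by
    refine le_trans ?_ (hsz.trans ?_)
    · gcongr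
    · gcongr
  have h4 : (((T.card : ℚ≥0) / (S.card : ℚ≥0) ^ d : ℚ≥0) : ℝ) ≤
      ((p.totalDegree / S.card : ℚ≥0) : ℝ) := by exact_mod_cast h3
  simpa using h4

end Laurent

/-! ### Floquet matrices with complex multipliers and their resultant -/

variable {d : ℕ} {q : Fin d → ℕ} (V : (Fin d → ℤ) → ℝ)

/-- The Floquet matrix for complex multipliers: `floquetMatrix q V k` is its value at
`z j = exp (2 π i k j)`. -/
def blochMatrix (q : Fin d → ℕ) (V : (Fin d → ℤ) → ℝ) (z : Fin d → ℂ) :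
    Matrix (Cell q) (Cell q) ℂ :=
  Matrix.of fun a b =>
    (∑ n ∈ neighbors a.toLattice,
      if ∀ j, (q j : ℤ) ∣ n j - b.toLattice j then
        ∏ j, z j ^ ((n j - b.toLattice j) / (q j : ℤ)) else 0) +
    if a = b then (V a.toLattice : ℂ) else 0

theorem floquetMatrix_eq_blochMatrix (k : Fin d → ℝ) :
    floquetMatrix q V k = blochMatrix q V fun j => Complex.exp (2 * Real.pi * Complex.I * k j) := by
  ext a b
  simp only [floquetMatrix, blochMatrix, Matrix.of_apply, schrodinger, LinearMap.add_apply,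
    Pi.add_apply, laplacian, potential, LinearMap.coe_mk, AddHom.coe_mk, floquetBasis_toLattice,
    mul_ite, mul_one, mul_zero]
  congr 1
  refine Finset.sum_congr rfl fun n _ => ?_
  rw [floquetBasis]
  congr 1
  rw [Finset.mul_sum, Complex.exp_sum]
  refine Finset.prod_congr rfl fun j _ => ?_
  rw [← Complex.exp_int_mul]
  congr 1
  ring

/-- Inverses are needed too: a neighbour that leaves the cell on the lower side contributes a
negative power of a multiplier. -/
theorem isLaurent_blochMatrix {w : (Fin d → ℂ) → (Fin d → ℂ) → Fin d → ℂ}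
    (hw : ∀ i, IsLaurent fun y z => w y z i) (hw' : ∀ i, IsLaurent fun y z => (w y z i)⁻¹)
    (a b : Cell q) : IsLaurent fun y z => blochMatrix q V (w y z) a b := by
  simp only [blochMatrix, Matrix.of_apply]
  refine (IsLaurent.sum _ fun n _ => ?_).add (IsLaurent.const _)
  split_ifs
  · exact IsLaurent.prod _ fun j _ => (hw j).zpow (hw' j) _
  · exact IsLaurent.const 0

/-- The determinant that vanishes when the Floquet matrices at `y z` and at `z` have a common
eigenvalue. -/
def bandResultant (q : Fin d → ℕ) (V : (Fin d → ℤ) → ℝ) (y z : Fin d → ℂ) : ℂ :=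
  (sylvester (blochMatrix q V (y * z)) (blochMatrix q V z)).det

theorem isLaurent_bandResultant : IsLaurent (bandResultant q V) := by
  refine IsLaurent.sylvester (A := fun y z => blochMatrix q V (y * z))
    (B := fun _ z => blochMatrix q V z)
    (isLaurent_blochMatrix V (w := fun y z => y * z) (fun i => ?_) fun i => ?_)
    (isLaurent_blochMatrix V (w := fun _ z => z) (fun i => ?_) fun i => ?_)
  · exact (IsLaurent.left i).mul (IsLaurent.right i)
  · simp only [Pi.mul_apply, mul_inv]
    exact (IsLaurent.left_inv i).mul (IsLaurent.right_inv i)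
  · exact IsLaurent.right i
  · exact IsLaurent.right_inv i

theorem exists_mulVec_eq_band_smul (k : Fin d → ℝ) (s : Fin (∏ j, q j)) :
    ∃ u : Cell q → ℂ, u ≠ 0 ∧ floquetMatrix q V k *ᵥ u = (band q V s k : ℂ) • u := by
  have hA := floquetMatrix_isHermitian q V k
  -- The same enumeration that Mathlib uses to pass from the sorted `eigenvalues₀` to `eigenvalues`,
  -- so that `i` labels an eigenvector for the chosen band.
  let e : Fin (Fintype.card (Cell q)) ≃ Cell q := Fintype.equivOfCardEq (Fintype.card_fin _)
  let i := e (Fin.rev (Fin.cast (card_cell q) s))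
  refine ⟨⇑(hA.eigenvectorBasis i), fun h => ?_, ?_⟩
  · refine hA.eigenvectorBasis.orthonormal.ne_zero i ?_
    ext x
    exact congrFun h x
  · have h : band q V s k = hA.eigenvalues i := by
      simp [band, Matrix.IsHermitian.eigenvalues, i, e]
    rw [h, hA.mulVec_eigenvectorBasis]
    ext x
    simp

theorem bandResultant_eq_zero {k k' : Fin d → ℝ} {s w : Fin (∏ j, q j)}
    (h : band q V s (k + k') = band q V w k) :
    bandResultant q V (fun j => Complex.exp (2 * Real.pi * Complex.I * k' j))
      (fun j => Complex.exp (2 * Real.pi * Complex.I * k j)) = 0 := by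
  obtain ⟨u, hu, hu'⟩ := exists_mulVec_eq_band_smul V (k + k') s
  obtain ⟨v, hv, hv'⟩ := exists_mulVec_eq_band_smul V k w
  rw [h, floquetMatrix_eq_blochMatrix] at hu'
  rw [floquetMatrix_eq_blochMatrix] at hv'
  refine det_sylvester_eq_zero hu hv ?_ hv'
  rw [← hu']
  congr 2
  ext j
  rw [Pi.mul_apply, ← Complex.exp_add]
  congr 1
  simp only [Pi.add_apply, Complex.ofReal_add]
  ring

/-! ### Nonvanishing of the resultant: degeneration to a cyclic shift -/

/-- The cyclic shift by `e_j` on the fundamental cell. -/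
def shiftMatrix (hq : ∀ i, 0 < q i) (j : Fin d) : Matrix (Cell q) (Cell q) ℂ :=
  Matrix.of fun a b => if b = residue q hq (a.toLattice + Pi.single j 1) then 1 else 0

theorem eq_residue_iff (hq : ∀ i, 0 < q i) (b : Cell q) (n : Fin d → ℤ) :
    b = residue q hq n ↔ ∀ i, (q i : ℤ) ∣ n i - b.toLattice i := by
  constructor
  · rintro rfl i
    rw [residue_toLattice]
    exact Int.dvd_self_sub_emod
  · intro h
    refine Cell.eq_of_dvd _ _ fun i => ?_
    rw [residue_toLattice]
    have h1 : (q i : ℤ) ∣ n i - n i % q i := Int.dvd_self_sub_emod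
    have := dvd_sub h1 (h i)
    rwa [sub_sub_sub_cancel_left] at this

theorem shiftMatrix_pow (hq : ∀ i, 0 < q i) (j : Fin d) (k : ℕ) :
    shiftMatrix hq j ^ k = Matrix.of fun a b =>
      if b = residue q hq (a.toLattice + Pi.single j (k : ℤ)) then 1 else 0 := by
  induction k with
  | zero =>
    ext a b
    have : residue q hq a.toLattice = a :=
      ((eq_residue_iff hq a _).mpr fun i => by simp).symm
    simp [this, Matrix.one_apply, eq_comm]
  | succ k ih =>
    ext a b
    rw [pow_succ, ih, Matrix.mul_apply]
    simp only [Matrix.of_apply, shiftMatrix, ite_mul, one_mul, zero_mul, Finset.sum_ite_eq',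
      Finset.mem_univ, if_true]
    congr 1
    rw [eq_residue_iff, eq_residue_iff, eq_iff_iff]
    refine forall_congr' fun i => ?_
    simp only [Pi.add_apply, residue_toLattice, Nat.cast_add, Nat.cast_one, Pi.single_add]
    have h1 : (q i : ℤ) ∣ (a.toLattice i + (Pi.single j (k : ℤ) : Fin d → ℤ) i) -
      (a.toLattice i + (Pi.single j (k : ℤ) : Fin d → ℤ) i) % q i := Int.dvd_self_sub_emod
    rw [← dvd_add_right h1]
    refine iff_of_eq (congrArg _ ?_)
    ring

theorem shiftMatrix_pow_self (hq : ∀ i, 0 < q i) (j : Fin d) : shiftMatrix hq j ^ q j = 1 := by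
  rw [shiftMatrix_pow]
  ext a b
  have : residue q hq (a.toLattice + Pi.single j (q j : ℤ)) = a := by
    refine ((eq_residue_iff hq a _).mpr fun i => ?_).symm
    by_cases h : i = j
    · subst h; simp
    · simp [h]
  simp [this, Matrix.one_apply, eq_comm]

/-- The Floquet matrix with multipliers `(c i) ^ q i` in directions `i ≠ j` and `(c j / ε) ^ q j` in
direction `j`, conjugated by a diagonal matrix and multiplied by `ε`; it extends to `ε = 0`. -/
def gaugedMatrix (q : Fin d → ℕ) (V : (Fin d → ℤ) → ℝ) (c : Fin d → ℂ) (j : Fin d) (ε : ℂ) :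
    Matrix (Cell q) (Cell q) ℂ :=
  Matrix.of fun a b =>
    (∑ n ∈ neighbors a.toLattice,
      if ∀ i, (q i : ℤ) ∣ n i - b.toLattice i then
        -- For a neighbour `n` the exponent of `ε` is 0, 1 or 2, so `toNat` truncates nothing; it is
        -- 0 only for `n = a + e_j`.
        (∏ i, c i ^ (n i - a.toLattice i)) * ε ^ (1 - (n j - a.toLattice j)).toNat else 0) +
    if a = b then ε * (V a.toLattice : ℂ) else 0

theorem continuous_gaugedMatrix (c : Fin d → ℂ) (j : Fin d) :
    Continuous (gaugedMatrix q V c j) := by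
  refine continuous_matrix fun a b => ?_
  simp only [gaugedMatrix, Matrix.of_apply]
  refine (continuous_finsetSum _ fun n _ => ?_).add ?_
  · split_ifs <;> fun_prop
  · split_ifs <;> fun_prop

theorem abs_sub_le_of_mem_neighbors {n n' : Fin d → ℤ} (h : n' ∈ neighbors n) (j : Fin d) :
    |n' j - n j| ≤ 1 := by
  rw [mem_neighbors] at h
  rw [← h, abs_sub_comm]
  exact Finset.single_le_sum (f := fun i => |n i - n' i|) (fun i _ => abs_nonneg _)
    (Finset.mem_univ j)

theorem add_single_mem_neighbors (n : Fin d → ℤ) (j : Fin d) :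
    n + Pi.single j 1 ∈ neighbors n := by
  rw [mem_neighbors, Finset.sum_eq_single j]
  · simp
  · intro i _ h
    simp [h]
  · simp

theorem eq_add_single_of_mem_neighbors {n n' : Fin d → ℤ} (h : n' ∈ neighbors n) {j : Fin d}
    (hj : n' j - n j = 1) : n' = n + Pi.single j 1 := by
  rw [mem_neighbors, ← Finset.add_sum_erase _ _ (Finset.mem_univ j), abs_sub_comm, hj] at h
  simp only [abs_one, add_eq_left] at h
  rw [Finset.sum_eq_zero_iff_of_nonneg fun i _ => abs_nonneg _] at h
  ext i
  by_cases hi : i = j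
  · subst hi
    simp only [Pi.add_apply, Pi.single_eq_same]
    omega
  · have := abs_eq_zero.mp (h i (by simp [hi]))
    simp only [Pi.add_apply, Pi.single_eq_of_ne hi]
    omega

/-- At `ε = 0` the potential and every hop carrying a positive power of `ε` disappear; only the hop
`a → a + e_j`, of weight `c j`, survives. -/
theorem gaugedMatrix_zero (hq : ∀ i, 0 < q i) (c : Fin d → ℂ) (j : Fin d) :
    gaugedMatrix q V c j 0 = c j • shiftMatrix hq j := by
  ext a b
  simp only [gaugedMatrix, Matrix.of_apply, shiftMatrix, Matrix.smul_apply, smul_eq_mul, zero_mul,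
    ite_self, add_zero, eq_residue_iff]
  rw [Finset.sum_eq_single_of_mem _ (add_single_mem_neighbors a.toLattice j)]
  · have : ∏ i, c i ^ ((a.toLattice + Pi.single j 1 : Fin d → ℤ) i - a.toLattice i) = c j := by
      rw [Finset.prod_eq_single j]
      · simp
      · intro i _ h
        simp [h]
      · simp
    rw [this]
    simp
  · intro n hn hne
    have h1 := (abs_le.mp (abs_sub_le_of_mem_neighbors hn j)).2
    have h2 : n j - a.toLattice j ≠ 1 := fun h => hne (eq_add_single_of_mem_neighbors hn h)
    have h3 : (1 - (n j - a.toLattice j)).toNat ≠ 0 := by omega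
    simp [zero_pow h3]

/-- The gauge by `x ^ b` spreads the multipliers `x i ^ q i` evenly over the cell: every hop `a → n`
gets weight `x ^ (n - a)`, wherever it crosses the cell boundary. With `x j = c j / ε`, the factor
`ε` removes the only pole, a simple one. -/
theorem smul_blochMatrix_mul_diagonal {c : Fin d → ℂ} (hc : ∀ i, c i ≠ 0) (j : Fin d) {ε : ℂ}
    (hε : ε ≠ 0) {x : Fin d → ℂ} (hx : x = fun i => c i * (Pi.mulSingle j ε⁻¹ : Fin d → ℂ) i) :
    (ε • blochMatrix q V fun i => x i ^ q i) *
        Matrix.diagonal (fun b : Cell q => ∏ i, x i ^ b.toLattice i) =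
      Matrix.diagonal (fun a : Cell q => ∏ i, x i ^ a.toLattice i) * gaugedMatrix q V c j ε := by
  have hx0 : ∀ i, x i ≠ 0 := by
    intro i
    rw [hx]
    refine mul_ne_zero (hc i) ?_
    by_cases h : i = j
    · subst h; simpa
    · simp [h]
  ext a b
  rw [Matrix.mul_diagonal, Matrix.diagonal_mul]
  simp only [gaugedMatrix, blochMatrix, Matrix.of_apply, Matrix.smul_apply, smul_eq_mul, mul_add,
    add_mul, Finset.mul_sum, Finset.sum_mul]
  congr 1
  · refine Finset.sum_congr rfl fun n hn => ?_
    by_cases h : ∀ i, (q i : ℤ) ∣ n i - b.toLattice i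
    · rw [if_pos h, if_pos h]
      have h1 : (∏ i, (x i ^ q i) ^ ((n i - b.toLattice i) / (q i : ℤ))) *
          ∏ i, x i ^ b.toLattice i = ∏ i, x i ^ n i := by
        rw [← Finset.prod_mul_distrib]
        refine Finset.prod_congr rfl fun i _ => ?_
        rw [← zpow_natCast, ← zpow_mul, Int.mul_ediv_cancel' (h i), ← zpow_add₀ (hx0 i),
          sub_add_cancel]
      have h2 : ∏ i, x i ^ n i = (∏ i, x i ^ a.toLattice i) *
          ∏ i, x i ^ (n i - a.toLattice i) := by
        rw [← Finset.prod_mul_distrib]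
        refine Finset.prod_congr rfl fun i _ => ?_
        rw [← zpow_add₀ (hx0 i), add_sub_cancel]
      have h3 : ∏ i, x i ^ (n i - a.toLattice i) =
          (∏ i, c i ^ (n i - a.toLattice i)) * ε⁻¹ ^ (n j - a.toLattice j) := by
        simp only [hx, mul_zpow, Finset.prod_mul_distrib]
        congr 1
        rw [Finset.prod_eq_single j]
        · simp
        · intro i _ hi
          simp [hi]
        · simp
      have h4 : ε * ε⁻¹ ^ (n j - a.toLattice j) = ε ^ (1 - (n j - a.toLattice j)).toNat := by
        have := (abs_le.mp (abs_sub_le_of_mem_neighbors hn j)).2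
        rw [← zpow_natCast, Int.toNat_of_nonneg (by omega), zpow_sub₀ hε, zpow_one, inv_zpow,
          div_eq_mul_inv]
      rw [mul_assoc, h1, h2, h3, ← h4]
      ring
    · simp [h]
  · by_cases h : a = b
    · subst h
      simp only [if_true]
      ring
    · simp [h]

/-- The determinant of the gauged pair is continuous in `ε` and nonzero at `ε = 0`, hence nonzero at
some `ε ≠ 0`, where the gauge can be undone. -/
theorem exists_bandResultant_ne_zero (hq : ∀ i, 0 < q i) {y : Fin d → ℂ} (hy : ∀ i, y i ≠ 0)
    (hy1 : y ≠ 1) : ∃ z : Fin d → ℂ, (∀ i, z i ≠ 0) ∧ bandResultant q V y z ≠ 0 := by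
  obtain ⟨j, hj⟩ := Function.ne_iff.mp hy1
  -- Roots of `y i`, so that `y i * z i` is a `q i`-th power whenever `z i` is, as the gauge
  -- requires.
  choose c hc using fun i => IsAlgClosed.exists_pow_nat_eq (y i) (hq i)
  have hc0 : ∀ i, c i ≠ 0 := fun i h => hy i (by rw [← hc i, h, zero_pow (hq i).ne'])
  have hcont : Continuous fun ε : ℂ =>
      (sylvester (gaugedMatrix q V c j ε) (gaugedMatrix q V 1 j ε)).det := by
    refine Continuous.matrix_det ?_
    have h1 := continuous_gaugedMatrix (q := q) V c j
    have h2 := continuous_gaugedMatrix (q := q) V 1 j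
    refine continuous_matrix fun a b => ?_
    simp only [sylvester, Matrix.sub_apply, Matrix.kroneckerMap_apply]
    exact ((h1.matrix_elem _ _).mul continuous_const).sub
      (continuous_const.mul (h2.matrix_elem _ _))
  have h0 : (sylvester (gaugedMatrix q V c j 0) (gaugedMatrix q V 1 j 0)).det ≠ 0 := by
    rw [gaugedMatrix_zero V hq, gaugedMatrix_zero V hq]
    refine det_sylvester_ne_zero_of_pow (k := q j) (c := y j) (c' := 1) ?_ ?_ hj
    · rw [smul_pow, shiftMatrix_pow_self, hc]
    · rw [Pi.one_apply, one_smul, one_smul, shiftMatrix_pow_self]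
  have hev : ∀ᶠ ε in 𝓝[≠] (0 : ℂ),
      (sylvester (gaugedMatrix q V c j ε) (gaugedMatrix q V 1 j ε)).det ≠ 0 :=
    (hcont.continuousAt.eventually_ne h0).filter_mono nhdsWithin_le_nhds
  obtain ⟨ε, hε, hε0⟩ := (hev.and self_mem_nhdsWithin).exists
  replace hε0 : ε ≠ 0 := hε0
  have hs : ∀ i, (Pi.mulSingle j ε⁻¹ : Fin d → ℂ) i ≠ 0 := by
    intro i
    by_cases h : i = j
    · subst h; simpa
    · simp [h]
  have hdet : ∀ x : Fin d → ℂ, (∀ i, x i ≠ 0) →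
      (Matrix.diagonal (fun b : Cell q => ∏ i, x i ^ b.toLattice i)).det ≠ 0 := by
    intro x hx
    rw [Matrix.det_diagonal]
    exact Finset.prod_ne_zero_iff.mpr fun b _ => Finset.prod_ne_zero_iff.mpr fun i _ =>
      zpow_ne_zero _ (hx i)
  -- The witness is `z j = ε⁻¹ ^ q j` and `z i = 1` for `i ≠ j`.
  refine ⟨fun i => (Pi.mulSingle j ε⁻¹ : Fin d → ℂ) i ^ q i, fun i => pow_ne_zero _ (hs i), ?_⟩
  have hA := smul_blochMatrix_mul_diagonal (q := q) V hc0 j hε0 rfl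
  have hB := smul_blochMatrix_mul_diagonal (q := q) V (c := 1) (by simp) j hε0 rfl
  simp only [Pi.one_apply, one_mul] at hB
  simp only [mul_pow, hc] at hA
  exact det_sylvester_ne_zero_of_conj (hdet _ fun i => mul_ne_zero (hc0 i) (hs i)) (hdet _ hs)
    hA hB hε

end PeriodicSchrodinger

end

/-! ### Counting coincidences on the grid of roots of unity -/

open PeriodicSchrodinger in
theorem corollary1p8 (d : ℕ) (q : Fin d → ℕ) (hq : ∀ j, 0 < q j)
    (V : (Fin d → ℤ) → ℝ) (hV : PeriodicSchrodinger.IsPeriodic q V)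
    (s w : Fin (∏ j, q j)) :
    Tendsto
      (fun N : ℕ =>
        ⨆ m : {m : Fin d → ℕ // m ∈ PeriodicSchrodinger.box d N ∧ m ≠ 0},
          ((Finset.card {r ∈ PeriodicSchrodinger.box d N |
              PeriodicSchrodinger.band q V s (fun j => ((r j : ℝ) + (m.1 j : ℝ)) / (N : ℝ)) -
                PeriodicSchrodinger.band q V w (fun j => (r j : ℝ) / (N : ℝ)) = 0} : ℕ) : ℝ) /
            (N : ℝ) ^ d)
      atTop (𝓝 0) := by
  obtain ⟨C, hC⟩ := (isLaurent_bandResultant (q := q) V).exists_card_le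
  have hlim : Tendsto (fun N : ℕ => (C : ℝ) / N) atTop (𝓝 0) :=
    tendsto_const_div_atTop_nhds_zero_nat _
  refine squeeze_zero' (Eventually.of_forall fun N => Real.iSup_nonneg fun m => by positivity)
    ?_ hlim
  filter_upwards [eventually_gt_atTop 0] with N hN
  -- Nonnegativity of the bound covers an empty index set (for instance `N = 1`), where the real
  -- supremum is 0 by convention.
  refine Real.iSup_le ?_ (by positivity)
  rintro ⟨m, hm, hm0⟩
  set ζ : ℂ := Complex.exp (2 * Real.pi * Complex.I / N) with hζ
  have hprim : IsPrimitiveRoot ζ N := Complex.isPrimitiveRoot_exp N hN.ne'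
  have hζ0 : ζ ≠ 0 := Complex.exp_ne_zero _
  have hexp : ∀ a : ℕ, Complex.exp (2 * Real.pi * Complex.I * ((a / N : ℝ) : ℂ)) = ζ ^ a := by
    intro a
    rw [hζ, ← Complex.exp_nat_mul]
    congr 1
    push_cast
    ring
  have hinj : Set.InjOn (fun a : ℕ => ζ ^ a) (Finset.range N) := fun a ha b hb h =>
    hprim.pow_inj (by simpa using ha) (by simpa using hb) h
  have hbox : ∀ r ∈ box d N, ∀ i, r i < N := fun r hr i => by
    simpa using Fintype.mem_piFinset.mp hr i
  -- Since `0 ≤ m i < N` and `ζ` is primitive, `ζ ^ m i = 1` forces `m i = 0`.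
  have hy1 : (fun i => ζ ^ m i) ≠ 1 := by
    intro h
    refine hm0 (funext fun i => ?_)
    exact hprim.pow_inj (hbox m hm i) hN (by simpa using congrFun h i)
  -- The grid is the set of all `N`-th roots of unity; `r ↦ ζ ^ r` is injective on the box, so
  -- passing to images preserves both cardinalities.
  have key := hC (fun i => ζ ^ m i) (fun i => pow_ne_zero _ hζ0)
    (exists_bandResultant_ne_zero V hq (fun i => pow_ne_zero _ hζ0) hy1)
    ((Finset.range N).image fun a => ζ ^ a)
    (by simp [hζ0])
    ({r ∈ box d N | band q V s (fun j => ((r j : ℝ) + (m j : ℝ)) / (N : ℝ)) -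
        band q V w (fun j => (r j : ℝ) / (N : ℝ)) = 0}.image fun r i => ζ ^ r i) ?_
  · rw [Finset.card_image_of_injOn hinj, Finset.card_range, Finset.card_image_of_injOn] at key
    · exact key
    · intro r hr r' hr' h
      rw [Finset.mem_coe, Finset.mem_filter] at hr hr'
      exact funext fun i => hprim.pow_inj (hbox r hr.1 i) (hbox r' hr'.1 i) (congrFun h i)
  · intro z hz
    obtain ⟨r, hr, rfl⟩ := Finset.mem_image.mp hz
    obtain ⟨hr, hrb⟩ := Finset.mem_filter.mp hr
    refine ⟨fun i => Finset.mem_image_of_mem _ (Finset.mem_range.mpr (hbox r hr i)), ?_⟩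
    simp only [← hexp]
    refine bandResultant_eq_zero V (s := s) (w := w) (k := fun j => (r j : ℝ) / N)
      (k' := fun j => (m j : ℝ) / N) ?_
    rw [← sub_eq_zero, ← hrb]
    congr 2
    ext j
    simp [add_div]
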